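/- Let $d\geq 2$, let $T$ be the $d$-regular rooted tree (its vertices are the finite words over an alphabet of $d$ letters, two words being adjacent when one is obtained from the other by appending a letter), and let $V_k$ be the set of words of length $k$. Let $X=\partial T$ be the space of infinite sequences over the alphabet, with the uniform Bernoulli measure $\mu$. Let $G\leq \mathrm{Aut}(T)$ be a branch group: $G$ acts transitively on every $V_k$, and for every $k$ the subgroup of $G$ generated by the rigid stabilizers $\mathrm{rist}_G(v)$, $v\in V_k$, has finite index in $G$; here $\mathrm{rist}_G(v)$ consists of the elements of $G$ that fix every vertex which does not have $v$ as a prefix. For $n\in\mathbb N$ let $\mathrm{diag}_n$ be the action of $G$ on $X^n_{\mathrm{Sym}}=X^n/\mathrm{Sym}(n)$ induced by the diagonal action $g(x_1,\dots,x_n)=(gx_1,\dots,gx_n)$, and let $\mu^n_{\mathrm{Sym}}$ be the image of the product measure $\mu^n$ on $X^n_{\mathrm{Sym}}$. Let $\mathcal E_n$ be the set of ergodic components of $\mathrm{diag}_n$, that is, of the measurable $G$-invariant sets $X_\alpha\subset X^n_{\mathrm{Sym}}$ of positive measure, considered up to null sets, such that $G$ acts ergodically with respect to the normalized restriction $\mu_\alpha$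 of $\mu^n_{\mathrm{Sym}}$ to $X_\alpha$. For $\alpha\in\mathcal E_n$ put $$\chi_\alpha(g)=\mu_\alpha\bigl(\mathrm{Fix}(\mathrm{diag}_n(g))\cap X_\alpha\bigr),\qquad g\in G.$$ Then the functions $\chi_\alpha$, $\alpha\in\mathcal E_n$, $n\in\mathbb N$, are pairwise distinct: if $\alpha\in\mathcal E_n$, $\beta\in\mathcal E_m$ and $\chi_\alpha=\chi_\beta$, then $n=m$ and $\alpha=\beta$. -/

import Mathlib

open MeasureTheory ProbabilityTheory

noncomputable section

namespace BranchGroups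

/-! ### The regular rooted tree and its automorphism group -/

/-- The regular rooted tree `T_d`: its vertices are the finite words over an alphabet with `d`
letters, and two words are adjacent if one is obtained from the other by appending a letter.
The root is the empty word. -/
def regularTree (d : ℕ) : SimpleGraph (List (Fin d)) where
  Adj v w := (∃ a, w = v ++ [a]) ∨ (∃ a, v = w ++ [a])
  symm := ⟨fun _ _ h => h.symm⟩
  loopless := ⟨by
    intro v h
    rcases h with ⟨a, h⟩ | ⟨a, h⟩ <;> simpa using congrArg List.length h⟩

/-- `Aut(T_d)`: all graph automorphisms of the tree; a group under composition. -/
abbrev TreeAut (d : ℕ) : Type := regularTree d ≃g regularTree d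

/-- The neighbours of the root are the one-letter words. -/
def rootNeighbors (d : ℕ) : (regularTree d).neighborSet [] ≃ Fin d := by
  refine (Equiv.ofBijective
    (fun a => (⟨[a], Or.inl ⟨a, rfl⟩⟩ : (regularTree d).neighborSet [])) ⟨?_, ?_⟩).symm
  · intro a b h
    simpa using congrArg Subtype.val h
  · rintro ⟨w, ⟨a, h⟩ | ⟨a, h⟩⟩
    · exact ⟨a, Subtype.ext (by simpa using h.symm)⟩
    · simp at h

/-- The neighbours of `u ++ [c]` are its `d` children and its parent. -/
def innerNeighbors (d : ℕ) (u : List (Fin d)) (c : Fin d) :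
    (regularTree d).neighborSet (u ++ [c]) ≃ Option (Fin d) := by
  refine (Equiv.ofBijective (fun o => (match o with
    | none => ⟨u, Or.inr ⟨c, rfl⟩⟩
    | some a => ⟨u ++ [c] ++ [a], Or.inl ⟨a, rfl⟩⟩ :
      (regularTree d).neighborSet (u ++ [c]))) ⟨?_, ?_⟩).symm
  · rintro (_ | a) (_ | b) h
    · rfl
    · simpa using congrArg (fun x => x.1.length) h
    · simpa using congrArg (fun x => x.1.length) h
    · simpa using congrArg Subtype.val h
  · rintro ⟨w, ⟨a, h⟩ | ⟨a, h⟩⟩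
    · exact ⟨some a, Subtype.ext h.symm⟩
    · exact ⟨none, Subtype.ext (List.append_inj' h rfl).1⟩

/-- Every automorphism of the tree fixes the root. -/
theorem TreeAut.map_root {d : ℕ} (g : TreeAut d) : g [] = [] := by
  rcases List.eq_nil_or_concat (g []) with h | ⟨u, c, h⟩
  · exact h
  · exfalso
    have e : (regularTree d).neighborSet [] ≃ (regularTree d).neighborSet (u ++ [c]) :=
      (g.mapNeighborSet []).trans (Equiv.setCongr (by rw [h]; simp))
    have := Fintype.card_congr
      ((rootNeighbors d).symm.trans (e.trans (innerNeighbors d u c)))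
    simp at this

/-- Automorphisms map children of `v` to children of the image of `v`. -/
theorem TreeAut.map_child {d : ℕ} (g : TreeAut d) (v : List (Fin d)) :
    ∀ a, ∃ b, g (v ++ [a]) = g v ++ [b] := by
  induction v using List.reverseRecOn with
  | nil =>
    intro a
    have h : (regularTree d).Adj (g []) (g ([] ++ [a])) :=
      g.map_rel_iff.2 (Or.inl ⟨a, rfl⟩)
    rcases h with h | ⟨b, h⟩
    · exact h
    · rw [g.map_root] at h
      simp at h
  | append_singleton u c ih =>
    intro a
    have h : (regularTree d).Adj (g (u ++ [c])) (g (u ++ [c] ++ [a])) :=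
      g.map_rel_iff.2 (Or.inl ⟨a, rfl⟩)
    rcases h with h | ⟨b, h⟩
    · exact h
    · exfalso
      obtain ⟨c', hc⟩ := ih c
      rw [hc] at h
      have h2 : u = u ++ [c] ++ [a] := g.injective (List.append_inj' h rfl).1
      simpa using congrArg List.length h2

/-- Automorphisms preserve the levels of the tree. -/
theorem TreeAut.length_map {d : ℕ} (g : TreeAut d) (v : List (Fin d)) :
    (g v).length = v.length := by
  induction v using List.reverseRecOn with
  | nil => rw [g.map_root]
  | append_singleton u c ih =>
    obtain ⟨b, hb⟩ := g.map_child u c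
    rw [hb]
    simp [ih]

/-! ### The boundary of the tree -/

/-- The boundary `∂T_d`, identified with the infinite sequences over the alphabet: a sequence `x`
stands for the infinite path through the vertices `x₀ ⋯ x_{k-1}`. -/
abbrev Boundary (d : ℕ) : Type := ℕ → Fin d

/-- The vertex of level `k` on the path `x`. -/
def vertexOn {d : ℕ} (x : Boundary d) (k : ℕ) : List (Fin d) := List.ofFn fun i : Fin k => x i

theorem length_vertexOn {d : ℕ} (x : Boundary d) (k : ℕ) : (vertexOn x k).length = k := by
  simp [vertexOn]

theorem vertexOn_succ {d : ℕ} (x : Boundary d) (k : ℕ) :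
    vertexOn x (k + 1) = vertexOn x k ++ [x k] := by
  simp only [vertexOn, List.ofFn_succ_last]
  rfl

theorem vertexOn_injective {d : ℕ} {x y : Boundary d} (h : ∀ k, vertexOn x k = vertexOn y k) :
    x = y := by
  funext k
  have := h (k + 1)
  rw [vertexOn_succ, vertexOn_succ, h k] at this
  simpa using this

/-- The action of an automorphism on paths: the `k`-th letter of the image of `x` is the last letter
of the image of the vertex of level `k + 1` on `x`. -/
def boundaryMap {d : ℕ} (g : TreeAut d) (x : Boundary d) : Boundary d := fun k =>
  (g (vertexOn x (k + 1))).get ⟨k, by rw [g.length_map, length_vertexOn]; exact k.lt_succ_self⟩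

/-- The path `g x` passes through the images under `g` of the vertices of the path `x`. -/
theorem vertexOn_boundaryMap {d : ℕ} (g : TreeAut d) (x : Boundary d) (k : ℕ) :
    vertexOn (boundaryMap g x) k = g (vertexOn x k) := by
  induction k with
  | zero => simp [vertexOn, g.map_root]
  | succ k ih =>
    rw [vertexOn_succ, ih]
    obtain ⟨b, hb⟩ := g.map_child (vertexOn x k) (x k)
    rw [← vertexOn_succ] at hb
    have hl : (g (vertexOn x k)).length = k := by rw [g.length_map, length_vertexOn]
    have : boundaryMap g x k = b := by
      simp [boundaryMap, hb, List.getElem_append_right, hl]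
    rw [hb, this]

instance boundaryAction (d : ℕ) : MulAction (TreeAut d) (Boundary d) where
  smul g x := boundaryMap g x
  one_smul x := vertexOn_injective fun k => vertexOn_boundaryMap 1 x k
  mul_smul g h x := vertexOn_injective fun k => by
    change vertexOn (boundaryMap (g * h) x) k = vertexOn (boundaryMap g (boundaryMap h x)) k
    rw [vertexOn_boundaryMap, vertexOn_boundaryMap, vertexOn_boundaryMap]
    rfl

/-- The uniform Bernoulli measure on the boundary: the infinite product of the uniform probability
measure on the alphabet, so that the paths through a given vertex of level `k` have
measure `d ^ (-k)`. -/
def uniformBernoulli (d : ℕ) : Measure (Boundary d) :=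
  Measure.infinitePi fun _ : ℕ => uniformOn (Set.univ : Set (Fin d))

/-! ### Branch groups -/

/-- The rigid stabilizer of the vertex `v`: the elements of `G` that act trivially on the vertices
outside of the subtree of words with prefix `v`. -/
def rist {d : ℕ} (G : Subgroup (TreeAut d)) (v : List (Fin d)) : Subgroup G where
  carrier := {g | ∀ w : List (Fin d), ¬ v <+: w → (g : TreeAut d) w = w}
  one_mem' := fun _ _ => rfl
  mul_mem' := by
    intro g h hg hh w hw
    change (g : TreeAut d) ((h : TreeAut d) w) = w
    rw [hh w hw, hg w hw]
  inv_mem' := by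
    intro g hg w hw
    change (g : TreeAut d).symm w = w
    rw [RelIso.symm_apply_eq, hg w hw]

/-- The rigid stabilizer of level `n`: the subgroup generated by the rigid stabilizers of the
vertices of level `n`. -/
def ristLevel {d : ℕ} (G : Subgroup (TreeAut d)) (n : ℕ) : Subgroup G :=
  ⨆ (v : List (Fin d)) (_ : v.length = n), rist G v

/-- A group `G` of automorphisms of the tree is branch if it is transitive on every level and all
its level rigid stabilizers have finite index in `G`. -/
structure IsBranch {d : ℕ} (G : Subgroup (TreeAut d)) : Prop where
  transitive : ∀ v w : List (Fin d), v.length = w.length → ∃ g ∈ G, g v = w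
  finiteIndex : ∀ n : ℕ, (ristLevel G n).FiniteIndex

/-! ### Symmetric powers and the diagonal action -/

/-- Two `n`-tuples are equivalent if they differ by a permutation of the coordinates. -/
def permSetoid (X : Type*) (n : ℕ) : Setoid (Fin n → X) where
  r x y := ∃ σ : Equiv.Perm (Fin n), x ∘ σ = y
  iseqv :=
    { refl := fun x => ⟨1, rfl⟩
      symm := by
        rintro x _ ⟨σ, rfl⟩
        exact ⟨σ⁻¹, by funext i; simp⟩
      trans := by
        rintro x _ _ ⟨σ, rfl⟩ ⟨τ, rfl⟩
        exact ⟨σ * τ, rfl⟩ }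

/-- The quotient `Xⁿ / Sym(n)`, with the quotient sigma-algebra when `X` is a measurable space. -/
abbrev SymPower (X : Type*) (n : ℕ) : Type _ := Quotient (permSetoid X n)

/-- The action of `G` on `Xⁿ / Sym(n)` induced by the diagonal action on `Xⁿ`. -/
instance symPowerAction (G X : Type*) [Group G] [MulAction G X] (n : ℕ) :
    MulAction G (SymPower X n) where
  smul g := Quotient.map (fun x i => g • x i) (by
    rintro x _ ⟨σ, rfl⟩
    exact ⟨σ, rfl⟩)
  one_smul := by
    rintro ⟨x⟩
    exact congrArg (Quotient.mk _) (funext fun i => one_smul G (x i))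
  mul_smul := by
    rintro g h ⟨x⟩
    exact congrArg (Quotient.mk _) (funext fun i => mul_smul g h (x i))

/-- The image on `Xⁿ / Sym(n)` of the product measure `μⁿ`. -/
def symMeasure {X : Type*} [MeasurableSpace X] (μ : Measure X) (n : ℕ) :
    Measure (SymPower X n) :=
  (Measure.pi fun _ : Fin n => μ).map (Quotient.mk (permSetoid X n))

/-! ### Ergodic components and their characters -/

section Components

variable (G : Type*) {Y : Type*} [Group G] [MulAction G Y] [MeasurableSpace Y] (ν : Measure Y)

/-- A measurable set `S` represents an ergodic component of the action of `G` on `(Y, ν)` if it has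
positive measure, is invariant up to null sets, and `G` acts ergodically with respect to the
normalized restriction `cond ν S` of `ν` to `S`. -/
structure IsErgodicComponent (S : Set Y) : Prop where
  measurableSet : MeasurableSet S
  pos : 0 < ν S
  invariant : ∀ g : G, (g • ·) ⁻¹' S =ᵐ[ν] S
  ergodic : ErgodicSMul G Y (cond ν S)

/-- Sets representing ergodic components are identified if they differ by a null set. -/
def componentSetoid : Setoid {S : Set Y // IsErgodicComponent G ν S} where
  r S T := S.1 =ᵐ[ν] T.1
  iseqv := ⟨fun _ => Filter.EventuallyEq.rfl, fun h => h.symm, fun h k => h.trans k⟩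

/-- The ergodic components of the action of `G` on `(Y, ν)`, as classes of sets modulo null
sets. -/
def ErgodicComponent : Type _ := Quotient (componentSetoid G ν)

/-- The function `g ↦ ν_S (Fix(g) ∩ S)`, where `ν_S` is the normalized restriction of `ν`
to `S`. -/
def fixFunction (S : Set Y) (g : G) : ℂ :=
  (((cond ν S).real (MulAction.fixedBy Y g ∩ S) : ℝ) : ℂ)

theorem fixFunction_congr {S T : Set Y} (h : S =ᵐ[ν] T) :
    fixFunction G ν S = fixFunction G ν T := by
  have h1 : cond ν S = cond ν T := by
    simp only [ProbabilityTheory.cond, measure_congr h, Measure.restrict_congr_set h]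
  have h2 : cond ν T ≪ ν := cond_absolutelyContinuous
  funext g
  have h3 : (MulAction.fixedBy Y g ∩ S : Set Y) =ᵐ[cond ν T] (MulAction.fixedBy Y g ∩ T : Set Y) :=
    Filter.EventuallyEq.inter Filter.EventuallyEq.rfl (h2.ae_eq h)
  simp only [fixFunction, h1, measureReal_congr h3]

variable {G ν}

/-- The character `χ_α` of an ergodic component `α`. -/
def ErgodicComponent.character (α : ErgodicComponent G ν) : G → ℂ :=
  Quotient.lift (fun S : {S : Set Y // IsErgodicComponent G ν S} => fixFunction G ν S.1)
    (fun _ _ h => fixFunction_congr G ν h) α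

end Components

/-- The set of ergodic components of the diagonal action of `G` on `Xⁿ / Sym(n)`, where `X` is
the boundary of the tree with the uniform Bernoulli measure. -/
abbrev DiagComponent {d : ℕ} (G : Subgroup (TreeAut d)) (n : ℕ) : Type :=
  ErgodicComponent G (symMeasure (uniformBernoulli d) n)

end BranchGroups

end

/-! A component `α` lifts to a permutation-invariant probability measure on `n`-tuples of boundary
points, almost all of them without repetitions: the law of a simple point process with `n` points.
The number `χ_α(g)` is the probability that `g` permutes the points of the configuration. As in
Rényi's theorem, a simple point process is determined by its void probabilities, so it suffices to
recover from `χ_α` the probability that no point lies in a given union `A` of cylinders of level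
`k`.

The group `ristOn G A` fixes every configuration that avoids `A`. If a configuration has a point `x`
in `A`, then the orbit of the level `m` vertex of `x` under this group has at least `d ^ m / [G :
ristLevel G k]` elements, by level transitivity and finite index. Hence a random element of the
group, as seen on level `m`, sends `x` to the level `m` vertex of one of the `n` points with
probability at most `n * [G : ristLevel G k] / d ^ m`. So averages of `χ_α` over lifts of the finite
image on level `m` converge to the void probability (`IsBranch.exists_spreading`,
`IsBranch.measureReal_voidSet_eq`).

Inclusion-exclusion turns void probabilities into the law of the set of level `k` vertices of the
configuration. Distinct points separate at deep levels, so these laws give `n`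
(`le_of_measureReal_voidSet_eq`) and the symmetric law itself (`eq_of_measureReal_voidSet_eq`), and
a normalized restriction determines its set modulo null sets (`ae_eq_of_cond_eq`). -/

noncomputable section
namespace BranchGroups

/-! ### The action on the levels of the tree -/

section Levels

variable {d : ℕ}

/-- The action of tree automorphisms on the words of a fixed length. -/
instance levelAction (d m : ℕ) : MulAction (TreeAut d) (List.Vector (Fin d) m) where
  smul g w := ⟨g w.1, (g.length_map w.1).trans w.2⟩
  one_smul _ := rfl
  mul_smul _ _ _ := rfl

/-- The vertex of level `k` on a path, as an element of the level. -/
def levelVertex (k : ℕ) (x : Boundary d) : List.Vector (Fin d) k :=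
  ⟨vertexOn x k, length_vertexOn x k⟩

theorem levelVertex_smul (m : ℕ) (g : TreeAut d) (x : Boundary d) :
    levelVertex m (g • x) = g • levelVertex m x :=
  Subtype.ext (vertexOn_boundaryMap g x m)

theorem levelVertex_eq_iff {k : ℕ} {x y : Boundary d} :
    levelVertex k x = levelVertex k y ↔ ∀ i < k, x i = y i := by
  refine Subtype.ext_iff.trans ?_
  change List.ofFn _ = List.ofFn _ ↔ _
  rw [List.ofFn_inj]
  constructor
  · intro h i hi
    exact congrFun h ⟨i, hi⟩
  · intro h
    funext i
    exact h i i.2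

theorem vertexOn_prefix_iff {x : Boundary d} {k j : ℕ} {v : List (Fin d)} (hv : v.length = k)
    (hkj : k ≤ j) : v <+: vertexOn x j ↔ vertexOn x k = v := by
  have h : vertexOn x k <+: vertexOn x j := by
    induction j, hkj using Nat.le_induction with
    | base => exact List.prefix_rfl
    | succ j _ ih =>
      rw [vertexOn_succ]
      exact ih.trans (List.prefix_append _ _)
  constructor
  · intro h'
    exact ((List.prefix_of_prefix_length_le h' h (by rw [hv, length_vertexOn])).eq_of_length
      (by rw [hv, length_vertexOn])).symm
  · rintro rfl
    exact h

/-- An element of the rigid stabilizer of `v` fixes the paths that do not pass through `v`. -/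
theorem smul_eq_self_of_mem_rist {G : Subgroup (TreeAut d)} {k : ℕ} {v : List (Fin d)}
    (hv : v.length = k) {g : G} (hg : g ∈ rist G v) {x : Boundary d} (hx : vertexOn x k ≠ v) :
    g • x = x := by
  refine vertexOn_injective fun j => (vertexOn_boundaryMap g.1 x j).trans (hg _ fun h => ?_)
  rcases le_total k j with hkj | hjk
  · exact hx ((vertexOn_prefix_iff hv hkj).1 h)
  · have hl := h.length_le
    rw [hv, length_vertexOn] at hl
    obtain rfl : k = j := le_antisymm hl hjk
    exact hx ((vertexOn_prefix_iff hv le_rfl).1 h)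

/-- An element of the rigid stabilizer of `v` preserves the set of paths through `v`. -/
theorem vertexOn_smul_of_mem_rist {G : Subgroup (TreeAut d)} {k : ℕ} {v : List (Fin d)}
    (hv : v.length = k) {g : G} (hg : g ∈ rist G v) {x : Boundary d} (hx : vertexOn x k = v) :
    vertexOn (g • x) k = v := by
  by_contra h
  -- If `g • x` left the cylinder, `g` would fix it, and cancelling `g` gives `g • x = x`.
  have h1 := smul_eq_self_of_mem_rist hv hg h
  rw [smul_left_cancel g h1] at h
  exact h hx

/-- The subgroup generated by the rigid stabilizers of the vertices in a set `A` of vertices of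
level `k`. -/
def ristOn (G : Subgroup (TreeAut d)) {k : ℕ} (A : Set (List.Vector (Fin d) k)) : Subgroup G :=
  ⨆ v ∈ A, rist G v.1

theorem smul_eq_self_of_mem_ristOn {G : Subgroup (TreeAut d)} {k : ℕ}
    {A : Set (List.Vector (Fin d) k)} {g : G} (hg : g ∈ ristOn G A) {x : Boundary d}
    (hx : levelVertex k x ∉ A) : g • x = x := by
  have h : ristOn G A ≤ MulAction.stabilizer G x := by
    refine iSup₂_le fun v hv r hr => smul_eq_self_of_mem_rist v.2 hr fun h => hx ?_
    rwa [show levelVertex k x = v from Subtype.ext h]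
  exact h hg

/-- On the paths through `v`, an element of the level rigid stabilizer acts as an element of the
rigid stabilizer of `v`. -/
theorem exists_mem_rist_of_mem_ristLevel {G : Subgroup (TreeAut d)} {k : ℕ} {v : List (Fin d)}
    (hv : v.length = k) {g : G} (hg : g ∈ ristLevel G k) :
    ∃ r ∈ rist G v, ∀ x : Boundary d, vertexOn x k = v → g • x = r • x := by
  -- The elements `g` with the required property form a subgroup, so it is enough to check the
  -- generators; those supported at another vertex act trivially here and get `r = 1`.
  let L : Subgroup G :=
    { carrier := {g | ∃ r ∈ rist G v, ∀ x : Boundary d, vertexOn x k = v → g • x = r • x}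
      one_mem' := ⟨1, one_mem _, fun _ _ => rfl⟩
      mul_mem' := by
        rintro g h ⟨r, hr, hgr⟩ ⟨s, hs, hhs⟩
        refine ⟨r * s, mul_mem hr hs, fun x hx => ?_⟩
        rw [mul_smul, mul_smul, hhs x hx, hgr _ (vertexOn_smul_of_mem_rist hv hs hx)]
      inv_mem' := by
        rintro g ⟨r, hr, hgr⟩
        refine ⟨r⁻¹, inv_mem hr, fun x hx => ?_⟩
        rw [inv_smul_eq_iff, hgr _ (vertexOn_smul_of_mem_rist hv (inv_mem hr) hx), smul_inv_smul] }
  have h : ristLevel G k ≤ L := by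
    refine iSup₂_le fun w hw r hr => ?_
    by_cases hwv : w = v
    · subst hwv
      exact ⟨r, hr, fun _ _ => rfl⟩
    · refine ⟨1, one_mem _, fun x hx => ?_⟩
      rw [one_smul]
      exact smul_eq_self_of_mem_rist hw hr fun h => hwv (h.symm.trans hx)
  exact h hg

/-- Above a vertex of `A` the two groups move paths in the same way. Thus the lower bound on orbits
of the finite index subgroup `ristLevel G k` passes to `ristOn G A`, which may have infinite index.
-/
theorem orbit_ristLevel_subset {G : Subgroup (TreeAut d)} {k : ℕ}
    {A : Set (List.Vector (Fin d) k)} {x : Boundary d} (hx : levelVertex k x ∈ A) (m : ℕ) :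
    MulAction.orbit (ristLevel G k) (levelVertex m x) ⊆
      MulAction.orbit (ristOn G A) (levelVertex m x) := by
  rintro _ ⟨⟨g, hg⟩, rfl⟩
  obtain ⟨r, hr, h⟩ := exists_mem_rist_of_mem_ristLevel (length_vertexOn x k) hg
  refine ⟨⟨r, (le_iSup₂_of_le (levelVertex k x) hx le_rfl : rist G _ ≤ ristOn G A) hr⟩, ?_⟩
  change r.1 • levelVertex m x = g.1 • levelVertex m x
  rw [← levelVertex_smul, ← levelVertex_smul]
  exact congrArg (levelVertex m) (h x rfl).symm

end Levels

/-! ### Orbit counting and almost uniform spreading -/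

/-- The orbits of a finite index subgroup of a transitive group are large. -/
theorem card_le_card_orbit_mul_index {Γ W : Type*} [Group Γ] [MulAction Γ W]
    [MulAction.IsPretransitive Γ W] [Finite W] (H : Subgroup Γ) [H.FiniteIndex] (w : W) :
    Nat.card W ≤ Nat.card (MulAction.orbit H w) * H.index := by
  have h1 : (MulAction.stabilizer Γ w).index = Nat.card W :=
    MulAction.index_stabilizer_of_transitive Γ w
  have : Nonempty W := ⟨w⟩
  have h0 : (MulAction.stabilizer Γ w).FiniteIndex := ⟨by rw [h1]; exact Nat.card_pos.ne'⟩
  have h2 : Nat.card (MulAction.orbit H w) = (MulAction.stabilizer Γ w).relIndex H := by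
    rw [Subgroup.relIndex]
    exact (MulAction.index_stabilizer H w).symm
  -- The right-hand side becomes the index of the intersection of the stabilizer with `H`, a nonzero
  -- multiple of the index of the stabilizer.
  rw [← h1, h2, ← Subgroup.inf_relIndex_right, Subgroup.relIndex_mul_index inf_le_right]
  exact Nat.le_of_dvd (Nat.pos_of_ne_zero Subgroup.FiniteIndex.index_ne_zero)
    (Subgroup.index_dvd_of_le inf_le_left)

/-- In a finite permutation group, the elements that map `w` to `w'` are at most as many as
the order of the group divided by the size of the orbit of `w`. -/
theorem card_smul_eq_mul_card_orbit_le {Γ W : Type*} [Group Γ] [Finite Γ] [MulAction Γ W]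
    (w w' : W) : Nat.card {g : Γ // g • w = w'} * Nat.card (MulAction.orbit Γ w) ≤ Nat.card Γ := by
  rw [← Nat.card_prod]
  by_cases he : ∃ g : Γ, g • w = w'
  · obtain ⟨g₀, hg₀⟩ := he
    have hk : ∀ u : MulAction.orbit Γ w, ∃ k : Γ, k • w' = u := by
      rintro ⟨_, ⟨k, rfl⟩⟩
      exact ⟨k * g₀⁻¹, by simp [← hg₀, mul_smul]⟩
    choose k hk using hk
    -- The product `k u * g` determines `u` as the image of `w`, and then `g` by cancellation.
    refine Nat.card_le_card_of_injective (fun p => k p.2 * p.1.1) ?_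
    rintro ⟨⟨g, hg⟩, u⟩ ⟨⟨g', hg'⟩, u'⟩ hp
    have hu : u = u' := by
      have := congrArg (fun γ : Γ => γ • w) hp
      simp only [mul_smul, hg, hg', hk] at this
      exact Subtype.ext this
    subst hu
    simpa using hp
  · have : IsEmpty ({g : Γ // g • w = w'} × MulAction.orbit Γ w) :=
      ⟨fun p => he ⟨p.1.1, p.1.2⟩⟩
    simp

/-- A branch group contains finite families of elements that fix all paths outside of a given set
of cylinders, and that move the vertices inside of these cylinders around almost uniformly. -/
theorem IsBranch.exists_spreading {d : ℕ} {G : Subgroup (TreeAut d)} (hG : IsBranch G) {k : ℕ}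
    (A : Set (List.Vector (Fin d) k)) (m : ℕ) :
    ∃ (ι : Type) (_ : Fintype ι) (_ : Nonempty ι) (h : ι → G),
      (∀ i (x : Boundary d), levelVertex k x ∉ A → h i • x = x) ∧
      ∀ (x : Boundary d) (w : List.Vector (Fin d) m), levelVertex k x ∈ A →
        Nat.card {i // levelVertex m (h i • x) = w} * d ^ m ≤
          Nat.card ι * (ristLevel G k).index := by
  -- The index set is the finite image of `ristOn G A` in the permutations of level `m`, and `h`
  -- picks one lift of each element. Each target in an orbit is then hit equally often.
  let φ := MulAction.toPermHom (ristOn G A) (List.Vector (Fin d) m)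
  have hφ : ∀ γ : φ.range, ∃ h : ristOn G A, φ h = γ.1 := fun γ => γ.2
  choose h hh using hφ
  refine ⟨φ.range, Fintype.ofFinite _, inferInstance, fun γ => (h γ).1,
    fun γ x hx => smul_eq_self_of_mem_ristOn (h γ).2 hx, fun x w hx => ?_⟩
  have hsmul : ∀ γ : φ.range, levelVertex m ((h γ).1 • x) = γ • levelVertex m x := by
    intro γ
    refine (levelVertex_smul m (h γ).1.1 x).trans ?_
    change φ (h γ) (levelVertex m x) = _
    rw [hh]
    rfl
  have horb : MulAction.orbit φ.range (levelVertex m x) =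
      MulAction.orbit (ristOn G A) (levelVertex m x) := by
    ext u
    constructor
    · rintro ⟨⟨_, g, rfl⟩, rfl⟩
      exact ⟨g, rfl⟩
    · rintro ⟨g, rfl⟩
      exact ⟨⟨φ g, g, rfl⟩, rfl⟩
  have := hG.finiteIndex k
  have : MulAction.IsPretransitive G (List.Vector (Fin d) m) := ⟨fun v w => by
    obtain ⟨g, hg, hgv⟩ := hG.transitive v.1 w.1 (v.2.trans w.2.symm)
    exact ⟨⟨g, hg⟩, Subtype.ext hgv⟩⟩
  have h1 := card_le_card_orbit_mul_index (ristLevel G k) (levelVertex m x)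
  have h2 := card_smul_eq_mul_card_orbit_le (Γ := φ.range) (levelVertex m x) w
  have h3 : Nat.card (List.Vector (Fin d) m) = d ^ m := by
    rw [Nat.card_eq_fintype_card, card_vector, Fintype.card_fin]
  have h4 : Nat.card (MulAction.orbit (ristLevel G k) (levelVertex m x)) ≤
      Nat.card (MulAction.orbit φ.range (levelVertex m x)) := by
    rw [horb]
    exact Nat.card_mono (Set.toFinite _) (orbit_ristLevel_subset hx m)
  simp only [hsmul]
  calc Nat.card {γ : φ.range // γ • levelVertex m x = w} * d ^ m
      ≤ Nat.card {γ : φ.range // γ • levelVertex m x = w} *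
        (Nat.card (MulAction.orbit φ.range (levelVertex m x)) * (ristLevel G k).index) := by
        rw [← h3]
        gcongr
        exact h1.trans (by gcongr)
    _ ≤ Nat.card φ.range * (ristLevel G k).index := by
        rw [← mul_assoc]
        gcongr

/-! ### Measurability -/

section Measurability

variable {d : ℕ}

instance (d k : ℕ) : MeasurableSpace (List.Vector (Fin d) k) := ⊤

instance (d k : ℕ) : DiscreteMeasurableSpace (List.Vector (Fin d) k) := ⟨fun _ => trivial⟩

theorem measurable_levelVertex (k : ℕ) :
    Measurable (levelVertex k : Boundary d → List.Vector (Fin d) k) := by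
  have h : (levelVertex k : Boundary d → List.Vector (Fin d) k) =
      List.Vector.ofFn ∘ fun x (i : Fin k) => x i :=
    funext fun x => Subtype.ext (List.Vector.toList_ofFn _).symm
  rw [h]
  exact Measurable.of_discrete.comp (measurable_pi_lambda _ fun i => measurable_pi_apply _)

theorem measurable_boundary_smul (g : TreeAut d) : Measurable fun x : Boundary d => g • x := by
  refine measurable_pi_lambda _ fun j => measurable_to_countable' fun a => ?_
  -- The letter `j` of `g • x` depends only on the vertex of level `j + 1` on `x`.
  have h : (fun x : Boundary d => (g • x) j) ⁻¹' {a} =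
      levelVertex (j + 1) ⁻¹' (levelVertex (j + 1) '' ((fun x : Boundary d => (g • x) j) ⁻¹' {a})) := by
    refine (Set.subset_preimage_image _ _).antisymm ?_
    rintro x ⟨y, hy, hxy⟩
    have h1 : levelVertex (j + 1) (g • y) = levelVertex (j + 1) (g • x) := by
      rw [levelVertex_smul, levelVertex_smul, hxy]
    exact (levelVertex_eq_iff.1 h1 j (Nat.lt_succ_self j)).symm.trans hy
  rw [h]
  exact measurable_levelVertex _ (MeasurableSet.of_discrete)

/-- The vertices of level `k` on the paths of a tuple. -/
def tupleVertex {n : ℕ} (k : ℕ) (x : Fin n → Boundary d) : Fin n → List.Vector (Fin d) k :=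
  fun i => levelVertex k (x i)

theorem measurable_tupleVertex {n : ℕ} (k : ℕ) :
    Measurable (tupleVertex k : (Fin n → Boundary d) → Fin n → List.Vector (Fin d) k) :=
  measurable_pi_lambda _ fun i => (measurable_levelVertex k).comp (measurable_pi_apply i)

/-- The tuples whose classes modulo permutations are fixed by `g`. -/
def symFixed (n : ℕ) (g : TreeAut d) : Set (Fin n → Boundary d) :=
  {x | ∃ σ : Equiv.Perm (Fin n), ∀ i, g • x (σ i) = x i}

theorem measurableSet_symFixed (n : ℕ) (g : TreeAut d) : MeasurableSet (symFixed n g) := by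
  have h : symFixed n g = ⋃ σ : Equiv.Perm (Fin n), ⋂ i, {x | g • x (σ i) = x i} := by
    ext x
    simp [symFixed]
  rw [h]
  exact MeasurableSet.iUnion fun σ => MeasurableSet.iInter fun i =>
    measurableSet_eq_fun ((measurable_boundary_smul g).comp (measurable_pi_apply _))
      (measurable_pi_apply _)

theorem exists_smul_eq_of_mem_symFixed {n : ℕ} {g : TreeAut d} {x : Fin n → Boundary d}
    (hx : x ∈ symFixed n g) (i : Fin n) : ∃ j, g • x i = x j := by
  obtain ⟨σ, hσ⟩ := hx
  exact ⟨σ.symm i, by simpa using hσ (σ.symm i)⟩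

end Measurability

/-! ### Void probabilities -/

section Void

variable {d : ℕ}

/-- The tuples none of whose paths passes through a vertex in `A`. -/
def voidSet (n : ℕ) {k : ℕ} (A : Set (List.Vector (Fin d) k)) : Set (Fin n → Boundary d) :=
  {x | ∀ i, levelVertex k (x i) ∉ A}

theorem measurableSet_voidSet (n : ℕ) {k : ℕ} (A : Set (List.Vector (Fin d) k)) :
    MeasurableSet (voidSet n A) := by
  have h : voidSet n A = tupleVertex k ⁻¹' {w | ∀ i, w i ∉ A} := rfl
  rw [h]
  exact measurable_tupleVertex k .of_discrete

/-- If no point lies in more than `N` of the sets `E i`, then their measures add up to at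
most `N`. -/
theorem sum_measureReal_le_of_card_le {Ω ι : Type*} [Fintype ι] [MeasurableSpace Ω]
    (P : Measure Ω) [IsProbabilityMeasure P] {E : ι → Set Ω} (hE : ∀ i, MeasurableSet (E i)) {N : ℝ}
    (hN : ∀ x, (Nat.card {i // x ∈ E i} : ℝ) ≤ N) : ∑ i, P.real (E i) ≤ N := by
  classical
  have h1 : ∀ i, P.real (E i) = ∫ x, (E i).indicator 1 x ∂P := fun i =>
    (integral_indicator_one (hE i)).symm
  have hint : ∀ i, Integrable ((E i).indicator (1 : Ω → ℝ)) P := fun i =>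
    (integrable_const (1 : ℝ)).indicator (hE i)
  simp_rw [h1]
  rw [← integral_finsetSum _ fun i _ => hint i]
  calc ∫ x, ∑ i, (E i).indicator (1 : Ω → ℝ) x ∂P ≤ ∫ _, N ∂P := by
        refine integral_mono (integrable_finsetSum _ fun i _ => hint i) (integrable_const N)
          fun x => ?_
        refine le_trans (le_of_eq ?_) (hN x)
        simp [Set.indicator_apply, Fintype.card_subtype]
    _ = N := by simp

variable {G : Subgroup (TreeAut d)}

/-- The void probabilities are determined up to small errors by the measures of the sets
`symFixed n g`. -/
theorem IsBranch.measureReal_voidSet_le (hG : IsBranch G) {n n' : ℕ}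
    {P : Measure (Fin n → Boundary d)} {Q : Measure (Fin n' → Boundary d)}
    [IsProbabilityMeasure P] [IsProbabilityMeasure Q]
    (hPQ : ∀ g ∈ G, P.real (symFixed n g) = Q.real (symFixed n' g)) {k : ℕ}
    (A : Set (List.Vector (Fin d) k)) (hd : 0 < d) (m : ℕ) :
    P.real (voidSet n A) ≤ Q.real (voidSet n' A) + n' * (ristLevel G k).index / (d : ℝ) ^ m := by
  obtain ⟨ι, _, _, h, hfix, hspread⟩ := hG.exists_spreading A m
  have hι : (0 : ℝ) < Fintype.card ι := by exact_mod_cast Fintype.card_pos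
  have hdm : (0 : ℝ) < (d : ℝ) ^ m := by positivity
  have hP : ∀ i, P.real (voidSet n A) ≤ P.real (symFixed n (h i).1) := fun i =>
    measureReal_mono fun x hx => ⟨1, fun j => hfix i _ (hx j)⟩
  have hQ : ∀ i, Q.real (symFixed n' (h i).1) ≤
      Q.real (voidSet n' A) + Q.real (symFixed n' (h i).1 \ voidSet n' A) := fun i => by
    refine (measureReal_mono ?_).trans (measureReal_union_le _ _)
    intro x hx
    by_cases hv : x ∈ voidSet n' A
    · exact Or.inl hv
    · exact Or.inr ⟨hx, hv⟩
  -- If `h i` permutes a tuple with a point `x i₀` in `A`, then `h i • x i₀` is one of `n'` points,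
  -- so its level `m` vertex is one of at most `n'` vertices; `hspread` bounds the number of such
  -- `i`.
  have hcount : ∑ i, Q.real (symFixed n' (h i).1 \ voidSet n' A) ≤
      Fintype.card ι * (n' * (ristLevel G k).index / (d : ℝ) ^ m) := by
    refine sum_measureReal_le_of_card_le Q
      (fun i => (measurableSet_symFixed n' _).diff (measurableSet_voidSet n' A)) fun x => ?_
    by_cases hv : x ∈ voidSet n' A
    · have : IsEmpty {i // x ∈ symFixed n' (h i).1 \ voidSet n' A} := ⟨fun i => i.2.2 hv⟩
      rw [Nat.card_of_isEmpty, Nat.cast_zero]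
      positivity
    · have hv' : ∃ i₀, levelVertex k (x i₀) ∈ A := by
        simpa [voidSet] using hv
      obtain ⟨i₀, hi₀⟩ := hv'
      have h1 : Nat.card {i // x ∈ symFixed n' (h i).1 \ voidSet n' A} ≤
          ∑ j, Nat.card {i // levelVertex m (h i • x i₀) = levelVertex m (x j)} := by
        rw [← Nat.card_sigma]
        have : ∀ i : {i // x ∈ symFixed n' (h i).1 \ voidSet n' A}, ∃ j,
            levelVertex m (h i • x i₀) = levelVertex m (x j) := fun i => by
          obtain ⟨j, hj⟩ := exists_smul_eq_of_mem_symFixed i.2.1 i₀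
          exact ⟨j, congrArg _ hj⟩
        choose j hj using this
        refine Nat.card_le_card_of_injective (fun i => ⟨j i, i.1, hj i⟩) ?_
        intro i i' hii
        simp only [Sigma.mk.injEq] at hii
        obtain ⟨e1, e2⟩ := hii
        -- The types of the second components depend on `j`, so they are only heterogeneously equal;
        -- with free indices the equality can be substituted.
        have : ∀ {a b : Fin n'} (p : {i // levelVertex m (h i • x i₀) = levelVertex m (x a)})
            (q : {i // levelVertex m (h i • x i₀) = levelVertex m (x b)}), a = b → HEq p q →
            p.1 = q.1 := by
          rintro a _ p q rfl hpq
          rw [eq_of_heq hpq]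
        exact Subtype.ext (this _ _ e1 e2)
      have h2 : Nat.card {i // x ∈ symFixed n' (h i).1 \ voidSet n' A} * d ^ m ≤
          n' * (Nat.card ι * (ristLevel G k).index) := by
        calc _ ≤ (∑ j, Nat.card {i // levelVertex m (h i • x i₀) = levelVertex m (x j)}) * d ^ m := by
              gcongr
          _ ≤ ∑ _j : Fin n', Nat.card ι * (ristLevel G k).index := by
              rw [Finset.sum_mul]
              exact Finset.sum_le_sum fun j _ => hspread _ _ hi₀
          _ = _ := by simp
      rw [Nat.card_eq_fintype_card (α := ι)] at h2
      have h3 : (Nat.card {i // x ∈ symFixed n' (h i).1 \ voidSet n' A} : ℝ) * (d : ℝ) ^ m ≤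
          n' * (Fintype.card ι * (ristLevel G k).index) := by exact_mod_cast h2
      rw [← mul_div_assoc, le_div_iff₀ hdm]
      linarith
  have hsum : Fintype.card ι * P.real (voidSet n A) ≤ Fintype.card ι *
      (Q.real (voidSet n' A) + n' * (ristLevel G k).index / (d : ℝ) ^ m) := by
    calc Fintype.card ι * P.real (voidSet n A) = ∑ _i : ι, P.real (voidSet n A) := by simp
      _ ≤ ∑ i, (Q.real (voidSet n' A) + Q.real (symFixed n' (h i).1 \ voidSet n' A)) :=
          Finset.sum_le_sum fun i _ => (hP i).trans ((hPQ _ (h i).2).le.trans (hQ i))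
      _ ≤ _ := by
          rw [Finset.sum_add_distrib, mul_add]
          simpa using hcount
  exact le_of_mul_le_mul_left hsum hι

/-- The index in the error term does not depend on `m`, so the error vanishes as `m` grows; the
roles of `P` and `Q` are symmetric. -/
theorem IsBranch.measureReal_voidSet_eq (hG : IsBranch G) (hd : 2 ≤ d) {n n' : ℕ}
    {P : Measure (Fin n → Boundary d)} {Q : Measure (Fin n' → Boundary d)}
    [IsProbabilityMeasure P] [IsProbabilityMeasure Q]
    (hPQ : ∀ g ∈ G, P.real (symFixed n g) = Q.real (symFixed n' g)) {k : ℕ}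
    (A : Set (List.Vector (Fin d) k)) : P.real (voidSet n A) = Q.real (voidSet n' A) := by
  have hd1 : (1 : ℝ) < d := by exact_mod_cast hd
  have hlim : ∀ a b : ℝ, Filter.Tendsto (fun m : ℕ => a + b / (d : ℝ) ^ m) Filter.atTop (nhds a) := by
    intro a b
    have h := (tendsto_pow_atTop_nhds_zero_of_lt_one (r := (d : ℝ)⁻¹) (by positivity)
      (inv_lt_one_of_one_lt₀ hd1)).const_mul b
    simpa [div_eq_mul_inv] using h.const_add a
  exact le_antisymm
    (ge_of_tendsto' (hlim _ _) fun m => hG.measureReal_voidSet_le hPQ A (by omega) m)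
    (ge_of_tendsto' (hlim _ _) fun m =>
      hG.measureReal_voidSet_le (fun g hg => (hPQ g hg).symm) A (by omega) m)

end Void

/-! ### Void probabilities determine symmetric measures -/

section Determination

variable {d : ℕ}

/-- The finite set of the vertices of level `k` on the paths of a tuple. -/
def vertexSet {n : ℕ} (k : ℕ) (x : Fin n → Boundary d) : Finset (List.Vector (Fin d) k) :=
  Finset.univ.image (tupleVertex k x)

theorem measurableSet_vertexSet_preimage {n k : ℕ} (E : Set (Finset (List.Vector (Fin d) k))) :
    MeasurableSet ((vertexSet k : (Fin n → Boundary d) → _) ⁻¹' E) :=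
  measurable_tupleVertex k (.of_discrete (s := {w | Finset.univ.image w ∈ E}))

theorem card_vertexSet_le {n : ℕ} (k : ℕ) (x : Fin n → Boundary d) : (vertexSet k x).card ≤ n :=
  Finset.card_image_le.trans (by simp)

theorem card_vertexSet_eq_iff {n : ℕ} {k : ℕ} {x : Fin n → Boundary d} :
    (vertexSet k x).card = n ↔ Function.Injective (tupleVertex k x) := by
  rw [vertexSet, ← Set.injOn_univ, ← Finset.coe_univ, ← Finset.card_image_iff, Finset.card_univ,
    Fintype.card_fin]

variable {n n' : ℕ} {P : Measure (Fin n → Boundary d)} {Q : Measure (Fin n' → Boundary d)}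
  [IsProbabilityMeasure P] [IsProbabilityMeasure Q]

/-- Avoiding the complement of `B` means that the vertex set is contained in `B`. This probability
is a sum over subsets of `B`, and induction removes the proper ones. -/
theorem measureReal_vertexSet_singleton_eq
    (h : ∀ (k : ℕ) (A : Set (List.Vector (Fin d) k)),
      P.real (voidSet n A) = Q.real (voidSet n' A)) (k : ℕ) (B : Finset (List.Vector (Fin d) k)) :
    P.real (vertexSet k ⁻¹' {B}) = Q.real (vertexSet k ⁻¹' {B}) := by
  have hvoid : ∀ (l : ℕ) (B : Finset (List.Vector (Fin d) k)),
      (vertexSet k ⁻¹' (B.powerset : Set (Finset (List.Vector (Fin d) k))) :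
        Set (Fin l → Boundary d)) = voidSet l (B : Set (List.Vector (Fin d) k))ᶜ := by
    intro l B
    ext x
    simp [vertexSet, voidSet, tupleVertex, Set.range_subset_iff]
  induction B using Finset.strongInduction with
  | H B ih =>
    have h1 := h k (B : Set (List.Vector (Fin d) k))ᶜ
    rw [← hvoid, ← hvoid,
      ← sum_measureReal_preimage_singleton _ fun _ _ => measurableSet_vertexSet_preimage _,
      ← sum_measureReal_preimage_singleton _ fun _ _ => measurableSet_vertexSet_preimage _,
      ← Finset.add_sum_erase _ _ (Finset.mem_powerset_self B),
      ← Finset.add_sum_erase _ _ (Finset.mem_powerset_self B)] at h1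
    have h2 : ∑ C ∈ B.powerset.erase B, P.real (vertexSet k ⁻¹' {C}) =
        ∑ C ∈ B.powerset.erase B, Q.real (vertexSet k ⁻¹' {C}) := by
      refine Finset.sum_congr rfl fun C hC => ih C ?_
      rw [Finset.mem_erase, Finset.mem_powerset] at hC
      exact hC.2.ssubset_of_ne hC.1
    linarith

theorem measureReal_vertexSet_eq
    (h : ∀ (k : ℕ) (A : Set (List.Vector (Fin d) k)),
      P.real (voidSet n A) = Q.real (voidSet n' A)) (k : ℕ)
    (E : Set (Finset (List.Vector (Fin d) k))) :
    P.real (vertexSet k ⁻¹' E) = Q.real (vertexSet k ⁻¹' E) := by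
  classical
  rw [← Set.coe_toFinset E,
    ← sum_measureReal_preimage_singleton _ fun _ _ => measurableSet_vertexSet_preimage _,
    ← sum_measureReal_preimage_singleton _ fun _ _ => measurableSet_vertexSet_preimage _]
  exact Finset.sum_congr rfl fun B _ => measureReal_vertexSet_singleton_eq h k B

/-- The tuples whose paths pass through different vertices of level `k`. -/
def separated (d n k : ℕ) : Set (Fin n → Boundary d) :=
  {x | Function.Injective (tupleVertex k x)}

theorem measurableSet_separated (d n k : ℕ) : MeasurableSet (separated d n k) :=
  measurable_tupleVertex k (.of_discrete (s := {w | Function.Injective w}))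

theorem separated_eq (d n k : ℕ) :
    separated d n k = vertexSet k ⁻¹' {B | B.card = n} :=
  Set.ext fun _ => card_vertexSet_eq_iff.symm

theorem tendsto_measureReal_compl_separated (hP : ∀ᵐ x ∂P, Function.Injective x) :
    Filter.Tendsto (fun k => P.real (separated d n k)ᶜ) Filter.atTop (nhds 0) := by
  have hanti : Antitone fun k => (separated d n k)ᶜ := by
    intro k l hkl
    exact Set.compl_subset_compl.2 fun x hx i j hij => hx (levelVertex_eq_iff.2 fun s hs =>
      levelVertex_eq_iff.1 hij s (hs.trans_le hkl))
  have hlim := tendsto_measure_iInter_atTop (μ := P)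
    (fun k => (measurableSet_separated d n k).compl.nullMeasurableSet) hanti
    ⟨0, measure_ne_top _ _⟩
  have hzero : P (⋂ k, (separated d n k)ᶜ) = 0 := by
    refine measure_mono_null ?_ hP
    intro x hx hinj
    -- A letter at which the two points differ; diagonal pairs get the dummy value `0`, so that the
    -- supremum below runs over all pairs. The `+ 1` there is needed because level `k` sees only the
    -- letters before `k`.
    have hsep : ∀ p : Fin n × Fin n, ∃ s, p.1 ≠ p.2 → x p.1 s ≠ x p.2 s := by
      rintro ⟨i, j⟩
      by_cases hij : i = j
      · exact ⟨0, fun h => absurd hij h⟩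
      · obtain ⟨s, hs⟩ := Function.ne_iff.1 (hinj.ne hij)
        exact ⟨s, fun _ => hs⟩
    choose s hs using hsep
    refine Set.mem_iInter.1 hx (Finset.univ.sup s + 1) fun i j hij => ?_
    by_contra hne
    exact hs (i, j) hne (levelVertex_eq_iff.1 hij _
      (Nat.lt_succ_of_le (Finset.le_sup (f := s) (Finset.mem_univ (i, j)))))
  rw [hzero] at hlim
  exact (ENNReal.tendsto_toReal ENNReal.zero_ne_top).comp hlim

/-- Void probabilities determine the number of points. -/
theorem le_of_measureReal_voidSet_eq (hQ : ∀ᵐ x ∂Q, Function.Injective x)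
    (h : ∀ (k : ℕ) (A : Set (List.Vector (Fin d) k)),
      P.real (voidSet n A) = Q.real (voidSet n' A)) : n' ≤ n := by
  by_contra! hlt
  -- A tuple of `n < n'` points never has `n'` vertices on a level, so under `Q` no level would
  -- separate the points, although almost surely some level does.
  have h1 : ∀ k, Q.real (separated d n' k)ᶜ = 1 := by
    intro k
    rw [probReal_compl_eq_one_sub (measurableSet_separated d n' k), separated_eq,
      ← measureReal_vertexSet_eq h]
    have : ((vertexSet k ⁻¹' {B | B.card = n'} : Set (Fin n → Boundary d))) = ∅ := by
      ext x
      have := card_vertexSet_le k x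
      simp only [Set.mem_preimage, Set.mem_ofPred_eq, Set.mem_empty_iff_false, iff_false]
      omega
    rw [this]
    simp
  have h2 := tendsto_measureReal_compl_separated hQ
  simp only [h1] at h2
  exact one_ne_zero (tendsto_nhds_unique tendsto_const_nhds h2)

variable {Q : Measure (Fin n → Boundary d)} [IsProbabilityMeasure Q]

/-- A measure on tuples is symmetric if it is invariant under permutations of the coordinates. -/
def IsSymmetric (P : Measure (Fin n → Boundary d)) : Prop :=
  ∀ σ : Equiv.Perm (Fin n), MeasurePreserving (fun x i => x (σ i)) P P

/-- The tuples with this vertex set split according to the order in which the vertices occur, and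
symmetry gives all `n!` orders the same probability. Ordered patterns are thus recovered from
unordered ones. -/
theorem IsSymmetric.measureReal_vertexSet (hP : IsSymmetric P) {k : ℕ}
    {w : Fin n → List.Vector (Fin d) k} (hw : Function.Injective w) :
    P.real (vertexSet k ⁻¹' {Finset.univ.image w}) =
      Fintype.card (Equiv.Perm (Fin n)) * P.real (tupleVertex k ⁻¹' {w}) := by
  classical
  let F : Finset (Fin n → List.Vector (Fin d) k) :=
    Finset.univ.image fun σ : Equiv.Perm (Fin n) => w ∘ σ
  have h1 : (vertexSet k ⁻¹' {Finset.univ.image w} : Set (Fin n → Boundary d)) =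
      tupleVertex k ⁻¹' (F : Set (Fin n → List.Vector (Fin d) k)) := by
    ext x
    simp only [Set.mem_preimage, Set.mem_singleton_iff, F, Finset.coe_image, Finset.coe_univ,
      Set.image_univ, Set.mem_range]
    constructor
    · intro h
      have hinj : Function.Injective (tupleVertex k x) := by
        rw [← card_vertexSet_eq_iff, h, Finset.card_image_of_injective _ hw, Finset.card_univ,
          Fintype.card_fin]
      have hmem : ∀ i, ∃ j, w j = tupleVertex k x i := by
        intro i
        have : tupleVertex k x i ∈ Finset.univ.image w := by
          rw [← h]
          exact Finset.mem_image_of_mem _ (Finset.mem_univ i)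
        simpa using this
      choose s hs using hmem
      have hsinj : Function.Injective s := fun i j hij => hinj (by rw [← hs, ← hs, hij])
      exact ⟨Equiv.ofBijective s (Finite.injective_iff_bijective.1 hsinj), funext hs⟩
    · rintro ⟨σ, hσ⟩
      rw [vertexSet, ← hσ]
      ext v
      simp only [Finset.mem_image, Finset.mem_univ, true_and, Function.comp_apply]
      exact ⟨fun ⟨i, hi⟩ => ⟨σ i, hi⟩, fun ⟨i, hi⟩ => ⟨σ.symm i, by simpa using hi⟩⟩
  have h2 : ∀ σ : Equiv.Perm (Fin n),
      P.real (tupleVertex k ⁻¹' {w ∘ σ}) = P.real (tupleVertex k ⁻¹' {w}) := by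
    intro σ
    have := (hP σ).measureReal_preimage
      (measurable_tupleVertex k (measurableSet_singleton (w ∘ σ))).nullMeasurableSet
    rw [← this]
    congr 1
    ext x
    exact σ.surjective.injective_comp_right.eq_iff
      (a := tupleVertex k x) (b := w)
  rw [h1, ← sum_measureReal_preimage_singleton _ fun _ _ =>
    measurable_tupleVertex k (measurableSet_singleton _), Finset.sum_image]
  · simp [h2]
  · intro σ _ τ _ h
    exact Equiv.ext fun i => hw (congrFun h i)

/-- The sets of tuples that depend on finitely many levels only. -/
def levelSets (d n : ℕ) : Set (Set (Fin n → Boundary d)) :=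
  {D | ∃ k, ∀ l, k ≤ l → tupleVertex l ⁻¹' (tupleVertex l '' D) = D}

/-- Since membership is tested on all levels from some level on, two sets can be compared on a
common one. -/
theorem isPiSystem_levelSets (d n : ℕ) : IsPiSystem (levelSets d n) := by
  rintro D ⟨k, hk⟩ D' ⟨k', hk'⟩ _
  refine ⟨max k k', fun l hl => (Set.subset_preimage_image _ _).antisymm' ?_⟩
  rintro x ⟨y, ⟨hy, hy'⟩, hxy⟩
  rw [← hk l (le_trans (le_max_left _ _) hl), ← hk' l (le_trans (le_max_right _ _) hl)]
  exact ⟨⟨y, hy, hxy⟩, ⟨y, hy', hxy⟩⟩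

theorem generateFrom_levelSets (d n : ℕ) :
    (MeasurableSpace.pi : MeasurableSpace (Fin n → Boundary d)) =
      MeasurableSpace.generateFrom (levelSets d n) := by
  apply le_antisymm
  · have h : @Measurable _ _ (MeasurableSpace.generateFrom (levelSets d n)) MeasurableSpace.pi
        (id : (Fin n → Boundary d) → Fin n → Boundary d) := by
      refine @measurable_pi_lambda _ _ _ (MeasurableSpace.generateFrom (levelSets d n)) _ _
        fun i => @measurable_pi_lambda _ _ _ (MeasurableSpace.generateFrom (levelSets d n)) _ _
        fun j s _ => MeasurableSpace.measurableSet_generateFrom ⟨j + 1, fun l hl => ?_⟩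
      refine (Set.subset_preimage_image _ _).antisymm' ?_
      rintro x ⟨y, hy, hxy⟩
      have := levelVertex_eq_iff.1 (congrFun hxy i) j (by omega)
      simpa [← this] using hy
    simpa using h.comap_le
  · refine MeasurableSpace.generateFrom_le ?_
    rintro D ⟨k, hk⟩
    rw [← hk k le_rfl]
    exact measurable_tupleVertex k .of_discrete

/-- On separated tuples, `D` is a finite union of patterns of distinct vertices, on which `P` and
`Q` agree. The remaining tuples have `P`-measure tending to zero as the level grows. -/
theorem measureReal_levelSet_le (hP : IsSymmetric P) (hQ : IsSymmetric Q)
    (hPinj : ∀ᵐ x ∂P, Function.Injective x)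
    (h : ∀ (k : ℕ) (A : Set (List.Vector (Fin d) k)),
      P.real (voidSet n A) = Q.real (voidSet n A)) {D : Set (Fin n → Boundary d)}
    (hD : D ∈ levelSets d n) : P.real D ≤ Q.real D := by
  classical
  obtain ⟨k, hk⟩ := hD
  have hlim : Filter.Tendsto (fun l => Q.real D + P.real (separated d n l)ᶜ) Filter.atTop
      (nhds (Q.real D)) := by
    simpa using (tendsto_measureReal_compl_separated hPinj).const_add (Q.real D)
  refine ge_of_tendsto hlim (Filter.eventually_atTop.2 ⟨k, fun l hl => ?_⟩)
  let E : Set (Fin n → List.Vector (Fin d) l) := tupleVertex l '' D ∩ {w | Function.Injective w}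
  have hE : tupleVertex l ⁻¹' E = D ∩ separated d n l := by
    rw [Set.preimage_inter, hk l hl]
    rfl
  have hw : ∀ w ∈ E, P.real (tupleVertex l ⁻¹' {w}) = Q.real (tupleVertex l ⁻¹' {w}) := by
    intro w hw
    have h1 := measureReal_vertexSet_eq h l {Finset.univ.image w}
    rw [hP.measureReal_vertexSet hw.2, hQ.measureReal_vertexSet hw.2] at h1
    exact mul_left_cancel₀ (by exact_mod_cast Fintype.card_ne_zero) h1
  have hPQ : P.real (D ∩ separated d n l) = Q.real (D ∩ separated d n l) := by
    rw [← hE, ← Set.coe_toFinset E,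
      ← sum_measureReal_preimage_singleton _ fun _ _ =>
        measurable_tupleVertex l (measurableSet_singleton _),
      ← sum_measureReal_preimage_singleton _ fun _ _ =>
        measurable_tupleVertex l (measurableSet_singleton _)]
    exact Finset.sum_congr rfl fun w hwE => hw w (Set.mem_toFinset.1 hwE)
  calc P.real D ≤ P.real (D ∩ separated d n l) + P.real (separated d n l)ᶜ := by
        refine (measureReal_mono ?_).trans (measureReal_union_le _ _)
        intro x hx
        by_cases hs : x ∈ separated d n l
        · exact Or.inl ⟨hx, hs⟩
        · exact Or.inr hs
    _ ≤ Q.real D + P.real (separated d n l)ᶜ := by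
        rw [hPQ]
        exact add_le_add (measureReal_mono Set.inter_subset_left) le_rfl

/-- Void probabilities determine a symmetric measure on tuples of different points. -/
theorem eq_of_measureReal_voidSet_eq (hP : IsSymmetric P) (hQ : IsSymmetric Q)
    (hPinj : ∀ᵐ x ∂P, Function.Injective x) (hQinj : ∀ᵐ x ∂Q, Function.Injective x)
    (h : ∀ (k : ℕ) (A : Set (List.Vector (Fin d) k)),
      P.real (voidSet n A) = Q.real (voidSet n A)) : P = Q := by
  refine ext_of_generate_finite _ (generateFrom_levelSets d n) (isPiSystem_levelSets d n)
    (fun D hD => ?_) (by simp)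
  rw [← measureReal_eq_measureReal_iff]
  exact (measureReal_levelSet_le hP hQ hPinj h hD).antisymm
    (measureReal_levelSet_le hQ hP hQinj (fun k A => (h k A).symm) hD)

end Determination

/-! ### The product measure -/

section ProductMeasure

theorem isProbabilityMeasure_uniformBernoulli {d : ℕ} (hd : 2 ≤ d) :
    IsProbabilityMeasure (uniformBernoulli d) := by
  have : NeZero d := ⟨by omega⟩
  unfold uniformBernoulli
  infer_instance

theorem nullSingletonClass_uniformBernoulli {d : ℕ} (hd : 2 ≤ d) : NullSingletonClass (uniformBernoulli d) := by
  have : NeZero d := ⟨by omega⟩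
  refine ⟨fun x => le_antisymm ?_ zero_le⟩
  -- The point lies in a cylinder of level `k`, which has measure `d ^ (-k)`.
  have h1 : ∀ k : ℕ, uniformBernoulli d {x} ≤ ((d : ENNReal)⁻¹) ^ k := by
    intro k
    have h := Measure.infinitePi_pi (fun _ : ℕ => uniformOn (Set.univ : Set (Fin d)))
      (s := Finset.range k) (t := fun i => {x i}) fun _ _ => measurableSet_singleton _
    simp only [uniformOn_univ, Measure.count_singleton, Fintype.card_fin, one_div,
      Finset.prod_const, Finset.card_range] at h
    rw [← h]
    refine measure_mono ?_
    rintro _ rfl i _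
    rfl
  refine ge_of_tendsto' (ENNReal.tendsto_pow_atTop_nhds_zero_of_lt_one ?_) h1
  rw [ENNReal.inv_lt_one]
  exact_mod_cast hd

/-- Two coordinates are independent with law `μ`, and by Fubini the diagonal is null because points
are. This makes the point processes simple. -/
theorem ae_injective_pi {X : Type*} [MeasurableSpace X] (μ : Measure X) [IsProbabilityMeasure μ] [NullSingletonClass μ]
    (hdiag : MeasurableSet {p : X × X | p.1 = p.2}) (n : ℕ) :
    ∀ᵐ x ∂(Measure.pi fun _ : Fin n => μ), Function.Injective x := by
  have h : ∀ i j : Fin n, i ≠ j → ∀ᵐ x ∂(Measure.pi fun _ : Fin n => μ), x i ≠ x j := by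
    intro i j hij
    have hind := (iIndepFun_pi (μ := fun _ : Fin n => μ) (X := fun _ x => x)
      fun _ => aemeasurable_id).indepFun hij
    have hmap := hind.map_prod_eq_prod_map_map
      (measurable_pi_apply i).aemeasurable (measurable_pi_apply j).aemeasurable
    rw [(measurePreserving_eval (fun _ : Fin n => μ) i).map_eq,
      (measurePreserving_eval (fun _ : Fin n => μ) j).map_eq] at hmap
    have hnull : (μ.prod μ) {p : X × X | p.1 = p.2} = 0 := by
      rw [Measure.measure_prod_null hdiag]
      refine Filter.Eventually.of_forall fun x => ?_
      have : Prod.mk x ⁻¹' {p : X × X | p.1 = p.2} = {x} := by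
        ext y
        simp [eq_comm]
      change μ (Prod.mk x ⁻¹' _) = 0
      rw [this]
      exact measure_singleton x
    rw [← hmap, Measure.map_apply (by fun_prop) hdiag] at hnull
    rw [ae_iff]
    simpa using hnull
  have h' : ∀ᵐ x ∂(Measure.pi fun _ : Fin n => μ), ∀ i j : Fin n, i ≠ j → x i ≠ x j := by
    simpa only [ae_all_iff] using h
  filter_upwards [h'] with x hx i j hij
  by_contra hne
  exact hx i j hne hij

theorem measurePreserving_pi_perm {X : Type*} [MeasurableSpace X] (μ : Measure X) [SigmaFinite μ]
    {n : ℕ} (σ : Equiv.Perm (Fin n)) :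
    MeasurePreserving (fun (x : Fin n → X) i => x (σ i)) (Measure.pi fun _ => μ)
      (Measure.pi fun _ => μ) := by
  have hm : Measurable fun (x : Fin n → X) i => x (σ i) :=
    measurable_pi_lambda _ fun i => measurable_pi_apply _
  refine ⟨hm, (Measure.pi_eq fun s hs => ?_).symm⟩
  rw [Measure.map_apply hm (MeasurableSet.univ_pi hs)]
  have : (fun (x : Fin n → X) i => x (σ i)) ⁻¹' Set.univ.pi s =
      Set.univ.pi fun i => s (σ.symm i) := by
    ext x
    simp only [Set.mem_preimage, Set.mem_univ_pi]
    exact ⟨fun h i => by simpa using h (σ.symm i), fun h i => by simpa using h (σ i)⟩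
  rw [this, Measure.pi_pi]
  exact Equiv.prod_comp σ.symm fun i => μ (s i)

end ProductMeasure

/-! ### Lifting components to tuples -/

section Components

theorem preimage_perm_mk_preimage {X : Type*} {n : ℕ} (S : Set (SymPower X n))
    (σ : Equiv.Perm (Fin n)) :
    (fun (x : Fin n → X) i => x (σ i)) ⁻¹' (Quotient.mk (permSetoid X n) ⁻¹' S) =
      Quotient.mk (permSetoid X n) ⁻¹' S := by
  ext x
  have : Quotient.mk (permSetoid X n) (fun i => x (σ i)) = Quotient.mk (permSetoid X n) x :=
    (Quotient.sound ⟨σ, rfl⟩ : Quotient.mk (permSetoid X n) x = _).symm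
  simp only [Set.mem_preimage, this]

variable {X : Type*} [MeasurableSpace X] {μ : Measure X} {n : ℕ}

theorem measurable_mk_symPower :
    Measurable (Quotient.mk (permSetoid X n)) := measurable_quotient_mk''

theorem symMeasure_apply {S : Set (SymPower X n)} (hS : MeasurableSet S) :
    symMeasure μ n S = Measure.pi (fun _ => μ) (Quotient.mk (permSetoid X n) ⁻¹' S) :=
  Measure.map_apply measurable_mk_symPower hS

/-- The normalized restriction of the product measure to the preimage of `S`. -/
def liftedMeasure (μ : Measure X) (S : Set (SymPower X n)) : Measure (Fin n → X) :=
  cond (Measure.pi fun _ => μ) (Quotient.mk (permSetoid X n) ⁻¹' S)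

theorem cond_symMeasure_apply {S E : Set (SymPower X n)} (hS : MeasurableSet S)
    (hE : MeasurableSet E) :
    cond (symMeasure μ n) S E = liftedMeasure μ S (Quotient.mk (permSetoid X n) ⁻¹' E) := by
  rw [cond_apply hS, liftedMeasure, cond_apply (measurable_mk_symPower hS), symMeasure_apply hS,
    symMeasure_apply (hS.inter hE)]
  rfl

/-- The preimage of `S` is a union of permutation classes, so conditioning on it keeps the symmetry
of the product measure. This supplies `IsSymmetric` for the lifted measures. -/
theorem measurePreserving_liftedMeasure [SigmaFinite μ] {S : Set (SymPower X n)}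
    (hS : MeasurableSet S) (σ : Equiv.Perm (Fin n)) :
    MeasurePreserving (fun (x : Fin n → X) i => x (σ i)) (liftedMeasure μ S)
      (liftedMeasure μ S) := by
  have h := measurePreserving_pi_perm μ σ
  refine ⟨h.measurable, Measure.ext fun E hE => ?_⟩
  have hS' := measurable_mk_symPower hS
  rw [Measure.map_apply h.measurable hE, liftedMeasure, cond_apply hS', cond_apply hS',
    ← h.measure_preimage (hS'.inter hE).nullMeasurableSet, Set.preimage_inter,
    preimage_perm_mk_preimage]

/-- Sets with the same normalized restrictions agree up to null sets. -/
theorem ae_eq_of_cond_eq {Ω : Type*} [MeasurableSpace Ω] {ν : Measure Ω} [IsFiniteMeasure ν]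
    {S T : Set Ω} (hS : MeasurableSet S) (hT : MeasurableSet T) (h : cond ν S = cond ν T) :
    S =ᵐ[ν] T := by
  have key : ∀ {A B : Set Ω}, MeasurableSet A → MeasurableSet B → cond ν A = cond ν B →
      ν (A \ B) = 0 := by
    intro A B hA hB hAB
    have h1 : cond ν A Bᶜ = 0 := by
      rw [hAB, cond_apply hB]
      simp
    -- The factor `(ν A)⁻¹` is nonzero because `ν` is finite, so the other factor, the measure of `A
    -- \ B`, vanishes.
    rw [cond_apply hA, mul_eq_zero, ENNReal.inv_eq_zero] at h1
    exact h1.resolve_left (measure_ne_top _ _)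
  exact ae_eq_set.2 ⟨key hS hT h, key hT hS h.symm⟩

theorem mk_preimage_fixedBy {d : ℕ} {G : Subgroup (TreeAut d)} (n : ℕ) (g : G) :
    Quotient.mk (permSetoid (Boundary d) n) ⁻¹' MulAction.fixedBy (SymPower (Boundary d) n) g =
      symFixed n g.1 := by
  ext x
  rw [Set.mem_preimage, MulAction.mem_fixedBy]
  change Quotient.mk (permSetoid (Boundary d) n) (fun i => g.1 • x i) = Quotient.mk _ x ↔ _
  rw [Quotient.eq]
  exact exists_congr fun σ => funext_iff

/-- This replaces the quotient by tuples: the character becomes the probability that `g` permutes a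
random tuple. -/
theorem fixFunction_eq {d : ℕ} {G : Subgroup (TreeAut d)} {n : ℕ}
    {S : Set (SymPower (Boundary d) n)} (hS : MeasurableSet S) (g : G) :
    fixFunction G (symMeasure (uniformBernoulli d) n) S g =
      ((liftedMeasure (uniformBernoulli d) S).real (symFixed n g.1) : ℝ) := by
  have hF : MeasurableSet (MulAction.fixedBy (SymPower (Boundary d) n) g) := by
    refine measurableSet_quotient.2 ?_
    exact (mk_preimage_fixedBy n g).symm ▸ measurableSet_symFixed n g.1
  rw [fixFunction, measureReal_def, Set.inter_comm, cond_inter_self hS,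
    cond_symMeasure_apply hS hF, mk_preimage_fixedBy, measureReal_def]

end Components

end BranchGroups
end

/-! ### Conclusion: equal characters come from equal components -/

theorem mainTheorem4 (d : ℕ) (hd : 2 ≤ d) (G : Subgroup (BranchGroups.TreeAut d))
    (hG : BranchGroups.IsBranch G) :
    Function.Injective
      (fun p : (Σ n : ℕ, BranchGroups.DiagComponent G n) =>
        BranchGroups.ErgodicComponent.character p.2) := by
  open BranchGroups in
  rintro ⟨n, α⟩ ⟨n', β⟩ h
  induction α using Quotient.inductionOn with | _ S
  induction β using Quotient.inductionOn with | _ T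
  obtain ⟨S, hS⟩ := S
  obtain ⟨T, hT⟩ := T
  have := isProbabilityMeasure_uniformBernoulli hd
  have := nullSingletonClass_uniformBernoulli hd
  have hprob : ∀ {l : ℕ} {R : Set (SymPower (Boundary d) l)},
      IsErgodicComponent G (symMeasure (uniformBernoulli d) l) R →
      IsProbabilityMeasure (liftedMeasure (uniformBernoulli d) R) := by
    intro l R hR
    refine cond_isProbabilityMeasure ?_
    rw [← symMeasure_apply hR.measurableSet]
    exact hR.pos.ne'
  have hinj : ∀ {l : ℕ} (R : Set (SymPower (Boundary d) l)),
      ∀ᵐ x ∂(liftedMeasure (uniformBernoulli d) R), Function.Injective x := fun R =>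
    cond_absolutelyContinuous.ae_le
      (ae_injective_pi _ (measurableSet_eq_fun measurable_fst measurable_snd) _)
  have := hprob hS
  have := hprob hT
  have hchar : ∀ g ∈ G, (liftedMeasure (uniformBernoulli d) S).real (symFixed n g) =
      (liftedMeasure (uniformBernoulli d) T).real (symFixed n' g) := by
    intro g hg
    have h1 : fixFunction G (symMeasure (uniformBernoulli d) n) S ⟨g, hg⟩ =
        fixFunction G (symMeasure (uniformBernoulli d) n') T ⟨g, hg⟩ := congrFun h ⟨g, hg⟩
    rw [fixFunction_eq hS.measurableSet, fixFunction_eq hT.measurableSet] at h1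
    exact_mod_cast h1
  -- From here on the characters enter only through the void probabilities.
  have hvoid := fun (k : ℕ) (A : Set (List.Vector (Fin d) k)) =>
    hG.measureReal_voidSet_eq hd hchar A
  obtain rfl : n = n' := le_antisymm
    (le_of_measureReal_voidSet_eq (hinj S) fun k A => (hvoid k A).symm)
    (le_of_measureReal_voidSet_eq (hinj T) hvoid)
  have hlift := eq_of_measureReal_voidSet_eq (measurePreserving_liftedMeasure hS.measurableSet)
    (measurePreserving_liftedMeasure hT.measurableSet) (hinj S) (hinj T) hvoid
  have hfin : IsFiniteMeasure (symMeasure (uniformBernoulli d) n) := by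
    unfold symMeasure
    infer_instance
  -- The normalized restrictions on the quotient are images of the lifted measures, which are now
  -- known to coincide.
  have hST : S =ᵐ[symMeasure (uniformBernoulli d) n] T := by
    refine ae_eq_of_cond_eq hS.measurableSet hT.measurableSet (Measure.ext fun E hE => ?_)
    rw [cond_symMeasure_apply hS.measurableSet hE, cond_symMeasure_apply hT.measurableSet hE, hlift]
  exact congrArg (Sigma.mk n) (Quotient.sound hST)
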